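/- Let $m\ge 2$ and let $\boldsymbol{w}_m$ be the $m$-bonacci word, i.e. the infinite fixed point, starting with $0$, of the morphism $\phi_m: 0\mapsto 01,\ 1\mapsto 02,\ \ldots,\ m-2\mapsto 0(m-1),\ m-1\mapsto 0$ on words over $\{0,1,\ldots,m-1\}$. The palindromic Crochemore factorization of an infinite word $\boldsymbol{w}$ is the factorization $\boldsymbol{w}=c_1c_2c_3\cdots$ into finite words in which each $c_i$ is the longest non-empty palindromic prefix of $c_ic_{i+1}c_{i+2}\cdots$ that has an occurrence in $\boldsymbol{w}$ at some position $j<|c_1c_2\cdots c_{i-1}|$ (positions are counted from $0$, and the occurrence may overlap $c_i$), or, if there is no such prefix, $c_i$ is a single letter. Define the p-singular words $z_n$, $n\ge -1$, by $z_{-1}=\varepsilon$, $z_0=0$, $$z_n=z_{n-2}z_{n-3}\cdots z_1z_0\; n\; z_0z_1\cdots z_{n-3}z_{n-2}\qquad(1\le n\le m-1),$$ $$z_n=z_{n-2}z_{n-3}\cdots z_{n-m}\; z_{n-m-1}\; z_{n-m}\cdots z_{n-3}z_{n-2}\qquad(n\ge m).$$ Put $$p_m=z_0z_1\cdots z_{m-3}\,z_{m-2}\,z_{m-3}\cdots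 z_1z_0\,(m-1),$$ $$Q(n)=z_{n-m+1}z_{n-m+2}\cdots z_{n-1}\,z_n\,z_{n-1}\cdots z_{n-m+2}z_{n-m+1}\qquad(n\ge m-2),$$ and let $q_1=z_0$, $q_{2l}=l$ (a single letter) for $1\le l\le m-1$, and $q_{2l+1}=z_0z_1\cdots z_{l-2}\,z_{l-1}\,z_{l-2}\cdots z_1z_0$ for $1\le l\le m-2$. Theorem. The words $q_1,\ldots,q_{2m-2}$ are palindromes and $$p_m=q_1q_2\cdots q_{2m-2}=z_0\cdot 1\cdot z_0\cdot 2\cdot(z_0z_1z_0)\cdot 3\cdots(z_0z_1\cdots z_{m-4}\,z_{m-3}\,z_{m-4}\cdots z_1z_0)\cdot(m-1).$$ The word $\boldsymbol{w}_m$ has exactly one palindromic Crochemore factorization. If it is indexed as $(c_{-m},c_{-m+1},c_{-m+2},\ldots)$, then its first $2m-2$ factors $c_{-m},\ldots,c_{m-3}$ are $q_1,\ldots,q_{2m-2}$, in this order, and $c_n=Q(n)$ for all $n\ge m-2$. -/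

import Mathlib

namespace MBonacci

section Words

variable {α : Type*}

/-- The finite word `u` occurs at position `j` in the infinite word `w` (indexed from `0`). -/
def OccursAt (w : ℕ → α) (u : List α) (j : ℕ) : Prop :=
  ∀ (i : ℕ) (hi : i < u.length), u[i] = w (j + i)

/-- The product `x 0 · x 1 ⋯ x (k - 1)` of the first `k` terms of a sequence of words. -/
def firstProd (x : ℕ → List α) (k : ℕ) : List α :=
  (List.range k).flatMap x

/-- `(x 0, x 1, x 2, …)` is a factorization of the infinite word `w`, i.e. `w = ∏ x n`:
all finite products are prefixes of `w`, and they exhaust `w`. -/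
def IsFactorization (w : ℕ → α) (x : ℕ → List α) : Prop :=
  (∀ k, OccursAt w (firstProd x k) 0) ∧ ∀ N, ∃ k, N < (firstProd x k).length

/-- `u` is a non-empty palindrome which is a prefix of the infinite word obtained from `w` by
removing its first `p` letters, and which has an occurrence in `w` at some position `j < p`
(the earlier occurrence may overlap position `p`). -/
def IsEarlierPalindrome (w : ℕ → α) (p : ℕ) (u : List α) : Prop :=
  u ≠ [] ∧ u.Palindrome ∧ OccursAt w u p ∧ ∃ j < p, OccursAt w u j

/-- `(c 0, c 1, c 2, …)` is the palindromic Crochemore factorization of the infinite word `w`: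
each `c i` is the longest palindromic prefix of `c i · c (i + 1) ⋯` having an occurrence in `w`
at some position `j < |c 0 ⋯ c (i - 1)|`, or a single letter if there is no such (non-empty)
prefix. -/
def IsPalCrochemore (w : ℕ → α) (c : ℕ → List α) : Prop :=
  IsFactorization w c ∧
  ∀ i, (IsEarlierPalindrome w (firstProd c i).length (c i) ∧
          ∀ u, IsEarlierPalindrome w (firstProd c i).length u → u.length ≤ (c i).length) ∨
       ((∀ u, ¬ IsEarlierPalindrome w (firstProd c i).length u) ∧ (c i).length = 1)

/-- The word `f a · f (a+1) ⋯ f (a+r-1) · f (a+r) · f (a+r-1) ⋯ f (a+1) · f a`. -/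
def mountain (f : ℕ → List α) (a r : ℕ) : List α :=
  (List.range r).flatMap (fun i => f (a + i)) ++ f (a + r) ++
    (List.range r).reverse.flatMap (fun i => f (a + i))

end Words

/-- The image of a letter under the `m`-bonacci morphism `0 ↦ 01, 1 ↦ 02, …, m-2 ↦ 0(m-1),
m-1 ↦ 0`. Letters are natural numbers; only the letters `0, …, m-1` are relevant, see
`mbonacci_lt`. -/
def phiLetter (m a : ℕ) : List ℕ :=
  if a + 1 < m then [0, a + 1] else [0]

/-- The `m`-bonacci morphism on finite words. -/
def phi (m : ℕ) (u : List ℕ) : List ℕ :=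
  u.flatMap (phiLetter m)

/-- The iterate `φ_m^n(0)`. -/
def h (m n : ℕ) : List ℕ :=
  (phi m)^[n] [0]

/-- The `m`-bonacci word, the limit of the words `φ_m^n(0)`, which is the fixed point of `φ_m`
starting with `0`; see `mbonacci_zero` and `mbonacci_fixed`. -/
def mbonacci (m : ℕ) (i : ℕ) : ℕ :=
  (h m i).getD i 0

theorem phi_append (m : ℕ) (u v : List ℕ) : phi m (u ++ v) = phi m u ++ phi m v := by
  simp [phi]

theorem h_succ (m n : ℕ) : h m (n + 1) = phi m (h m n) := by
  simp only [h, Function.iterate_succ_apply']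

theorem phi_isPrefix (m : ℕ) {u v : List ℕ} (huv : u <+: v) : phi m u <+: phi m v := by
  obtain ⟨t, rfl⟩ := huv
  exact ⟨phi m t, (phi_append m u t).symm⟩

theorem h_isPrefix_succ {m : ℕ} (hm : 2 ≤ m) (n : ℕ) : h m n <+: h m (n + 1) := by
  induction n with
  | zero => exact ⟨[1], by simp [h, phi, phiLetter, show 1 < m by omega]⟩
  | succ n ih => rw [h_succ, h_succ]; exact phi_isPrefix m ih

theorem h_isPrefix {m : ℕ} (hm : 2 ≤ m) {n k : ℕ} (hnk : n ≤ k) : h m n <+: h m k := by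
  induction hnk with
  | refl => exact List.prefix_rfl
  | step _ ih => exact ih.trans (h_isPrefix_succ hm _)

theorem length_le_length_phi (m : ℕ) (u : List ℕ) : u.length ≤ (phi m u).length := by
  induction u with
  | nil => simp
  | cons a u ih =>
    have : 1 ≤ (phiLetter m a).length := by unfold phiLetter; split <;> simp
    simp only [phi, List.flatMap_cons, List.length_append, List.length_cons] at *
    omega

theorem lt_length_h {m : ℕ} (hm : 2 ≤ m) (n : ℕ) : n < (h m n).length := by
  induction n with
  | zero => simp [h]
  | succ n ih =>
    obtain ⟨t, ht⟩ := h_isPrefix hm (Nat.zero_le n)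
    have h0 : h m 0 = [0] := rfl
    have h1 := length_le_length_phi m t
    have h2 : (phi m [0]).length = 2 := by simp [phi, phiLetter, show 1 < m by omega]
    rw [h0] at ht
    rw [h_succ, ← ht, phi_append, List.length_append, h2]
    rw [← ht, List.length_append, List.length_singleton] at ih
    omega

/-- The `m`-bonacci word is the limit of the words `φ_m^n(0)`. -/
theorem mbonacci_occursAt {m : ℕ} (hm : 2 ≤ m) (n : ℕ) : OccursAt (mbonacci m) (h m n) 0 := by
  intro i hi
  have hi' := lt_length_h hm i
  rw [Nat.zero_add, mbonacci, List.getD_eq_getElem _ _ hi']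
  rcases le_total n i with hni | hni
  · exact List.IsPrefix.getElem (h_isPrefix hm hni) hi
  · exact (List.IsPrefix.getElem (h_isPrefix hm hni) hi').symm

theorem mbonacci_zero (m : ℕ) : mbonacci m 0 = 0 := rfl

/-- The `m`-bonacci word is a fixed point of `φ_m`: the image of each prefix is a prefix. -/
theorem mbonacci_fixed {m : ℕ} (hm : 2 ≤ m) (n : ℕ) :
    OccursAt (mbonacci m) (phi m ((List.range n).map (mbonacci m))) 0 := by
  have hpre : (List.range n).map (mbonacci m) <+: h m n := by
    rw [List.prefix_iff_eq_take]
    have hl := lt_length_h hm n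
    apply List.ext_getElem
    · simp; omega
    · intro i h1 h2
      have hi : i < n := by simpa using h1
      have := mbonacci_occursAt hm n i (by omega)
      simp [this]
  have hp := phi_isPrefix m hpre
  rw [← h_succ] at hp
  intro i hi
  rw [List.IsPrefix.getElem hp hi]
  exact mbonacci_occursAt hm (n + 1) i _

/-- Only the letters `0, …, m-1` occur in the `m`-bonacci word. -/
theorem mbonacci_lt {m : ℕ} (hm : 2 ≤ m) (i : ℕ) : mbonacci m i < m := by
  have key : ∀ n, ∀ a ∈ h m n, a < m := by
    intro n
    induction n with
    | zero => intro a ha; simp [h] at ha; omega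
    | succ n ih =>
      intro a ha
      rw [h_succ, phi, List.mem_flatMap] at ha
      obtain ⟨b, _, ha⟩ := ha
      unfold phiLetter at ha
      split at ha <;> simp at ha <;> omega
  rw [mbonacci, List.getD_eq_getElem _ _ (lt_length_h hm i)]
  exact key i _ (List.getElem_mem _)

/-- The p-singular words with index shifted by one: `zShift m k` is `z_{k-1}`. Thus
`z_{-1} = ε`, `z_0 = 0`, and with `n = k + 1` in the third clause
* `z_n = z_{n-2} ⋯ z_0 · n · z_0 ⋯ z_{n-2}` for `1 ≤ n ≤ m - 1`,
* `z_n = z_{n-2} ⋯ z_{n-m} · z_{n-m-1} · z_{n-m} ⋯ z_{n-2}` for `n ≥ m`. -/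
def zShift (m : ℕ) : ℕ → List ℕ
  | 0 => []
  | 1 => [0]
  | k + 2 =>
    if k + 1 < m then
      (List.range k).flatMap (fun i => zShift m (k - i)) ++ [k + 1] ++
        (List.range k).reverse.flatMap (fun i => zShift m (k - i))
    else
      (List.range (m - 1)).flatMap (fun i => zShift m (k - i)) ++ zShift m (k + 1 - m) ++
        (List.range (m - 1)).reverse.flatMap (fun i => zShift m (k - i))
termination_by k => k
decreasing_by all_goals omega

/-- The p-singular word `z_n`, for `n ≥ 0`. -/
def z (m n : ℕ) : List ℕ :=
  zShift m (n + 1)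

/-- `p_m = z_0 z_1 ⋯ z_{m-3} z_{m-2} z_{m-3} ⋯ z_1 z_0 (m-1)`, for `m ≥ 2`. -/
def pWord (m : ℕ) : List ℕ :=
  mountain (z m) 0 (m - 2) ++ [m - 1]

/-- `Q(n) = z_{n-m+1} ⋯ z_{n-1} z_n z_{n-1} ⋯ z_{n-m+1}`, for `n ≥ m - 2`
(recall that `z_{n-m+1} = zShift m (n + 2 - m)`). -/
def Q (m n : ℕ) : List ℕ :=
  mountain (zShift m) (n + 2 - m) (m - 1)

/-- The factors `q_1, q_2, …` of the factorization
`z_0 · 1 · z_0 · 2 · (z_0 z_1 z_0) · 3 · (z_0 z_1 z_2 z_1 z_0) · 4 ⋯`: here `q_1 = z_0`,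
`q_{2l} = l` and `q_{2l+1} = z_0 ⋯ z_{l-2} z_{l-1} z_{l-2} ⋯ z_0` for `l ≥ 1`. The index is
shifted by one: `q m k` is `q_{k+1}`. -/
def q (m k : ℕ) : List ℕ :=
  if k = 0 then z m 0
  else if k % 2 = 1 then [(k + 1) / 2]
  else mountain (z m) 0 (k / 2 - 1)

end MBonacci

/-! Uniqueness is greedy: the earlier factors fix the starting position of the next one, and the
rule fixes its length. It remains to verify that the proposed factors obey the rule.

The engine is desubstitution. Every `φ`-block starts with `0` and contains no other `0`, so the
zeros of the word mark the block boundaries. A factor that starts and ends with `0` is thus `φ(v)0`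
for a factor `v`, and `φ(v)0` is a palindrome exactly when `v` is. Hence a longest earlier
palindrome `u` at a position `p > 0` yields the longest one `φ(u)0` at the image `pos m p`
(`IsMaxPal.image`). If the letter after `pos m p` is nonzero, deleting the two outer zeros gives the
longest one at the next position (`IsMaxPal.strip`).

Let `P_0 = ε` and `P_{l+1} = φ(P_l)0`. For `l < m` one has `φ^l(0) = P_l l` and `P_{l+1} = P_l l
P_l`. So the initial factors alternate between a new letter `l`, which has no earlier occurrence,
and `P_l`, which is maximal at position `|φ^l(0)|` (`isMaxPal_length_h`).

For the tail, `φ` carries each `Q`-word to the next up to one boundary `0`, on a side given by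
parity (`phi_mountain`). Starting from `P_{m-1}`, induction alternates the image step with image
followed by stripping (`isMaxPal_start`). -/

namespace MBonacci

/-! ### Occurrences of words and greedy uniqueness -/

section Occurrences

variable {α : Type*} {w : ℕ → α}

theorem occursAt_nil (j : ℕ) : OccursAt w [] j := fun i hi => absurd hi (by simp)

theorem occursAt_cons {a : α} {u : List α} {j : ℕ} :
    OccursAt w (a :: u) j ↔ a = w j ∧ OccursAt w u (j + 1) := by
  constructor
  · intro h
    refine ⟨h 0 (by simp), fun i hi => ?_⟩
    have := h (i + 1) (by simpa using hi)
    simpa [add_assoc, add_comm 1 i] using this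
  · rintro ⟨h0, h1⟩ i hi
    cases i with
    | zero => exact h0
    | succ i =>
      have := h1 i (by simpa using hi)
      simpa [add_assoc, add_comm 1 i] using this

theorem occursAt_append {u v : List α} {j : ℕ} :
    OccursAt w (u ++ v) j ↔ OccursAt w u j ∧ OccursAt w v (j + u.length) := by
  induction u generalizing j with
  | nil => simp [occursAt_nil]
  | cons a u ih =>
    simp only [List.cons_append, occursAt_cons, ih, List.length_cons, and_assoc]
    rw [show j + 1 + u.length = j + (u.length + 1) by omega]

theorem occursAt_singleton {a : α} {j : ℕ} : OccursAt w [a] j ↔ a = w j := by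
  simp [occursAt_cons, occursAt_nil]

theorem OccursAt.eq_of_length_eq {u v : List α} {j : ℕ} (hu : OccursAt w u j)
    (hv : OccursAt w v j) (h : u.length = v.length) : u = v :=
  List.ext_getElem h fun i h1 h2 => (hu i h1).trans (hv i h2).symm

theorem occursAt_map_range (j n : ℕ) :
    OccursAt w ((List.range n).map fun i => w (j + i)) j := by
  intro i hi
  simp

theorem firstProd_succ (x : ℕ → List α) (k : ℕ) :
    firstProd x (k + 1) = firstProd x k ++ x k := by
  simp [firstProd, List.range_succ]

theorem firstProd_congr {x y : ℕ → List α} {k : ℕ} (h : ∀ i < k, x i = y i) :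
    firstProd x k = firstProd y k := by
  induction k with
  | zero => rfl
  | succ k ih =>
    rw [firstProd_succ, firstProd_succ, ih fun i hi => h i (by omega), h k (by omega)]

/-- `u` is the longest word among the empty word and the palindromes starting at position `p`
which also occur at an earlier position. -/
def IsMaxPal (w : ℕ → α) (p : ℕ) (u : List α) : Prop :=
  (u = [] ∨ IsEarlierPalindrome w p u) ∧ ∀ v, IsEarlierPalindrome w p v → v.length ≤ u.length

theorem IsMaxPal.occursAt {p : ℕ} {u : List α} (h : IsMaxPal w p u) : OccursAt w u p := by
  rcases h.1 with rfl | h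
  · exact occursAt_nil p
  · exact h.2.2.1

theorem IsMaxPal.palindrome {p : ℕ} {u : List α} (h : IsMaxPal w p u) : u.Palindrome := by
  rcases h.1 with rfl | h
  · exact .nil
  · exact h.2.1

theorem IsPalCrochemore.occursAt {c : ℕ → List α} (h : IsPalCrochemore w c) (k : ℕ) :
    OccursAt w (c k) (firstProd c k).length := by
  have := h.1.1 (k + 1)
  rw [firstProd_succ, occursAt_append] at this
  simpa using this.2

theorem IsPalCrochemore.unique {c d : ℕ → List α} (hc : IsPalCrochemore w c)
    (hd : IsPalCrochemore w d) : c = d := by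
  funext k
  induction k using Nat.strong_induction_on with
  | _ k ih =>
    have hp := firstProd_congr ih
    have hco := hc.occursAt k
    have hdo := hd.occursAt k
    have hc2 := hc.2 k
    have hd2 := hd.2 k
    rw [hp] at hco hc2
    refine hco.eq_of_length_eq hdo ?_
    rcases hc2 with ⟨h1, h2⟩ | ⟨h1, h2⟩ <;> rcases hd2 with ⟨h3, h4⟩ | ⟨h3, h4⟩
    · exact le_antisymm (h4 _ h1) (h2 _ h3)
    · exact absurd h1 (h3 _)
    · exact absurd h3 (h1 _)
    · rw [h2, h4]

theorem isPalCrochemore_of_occursAt {c : ℕ → List α}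
    (h : ∀ k, c k ≠ [] ∧ OccursAt w (c k) (firstProd c k).length ∧
      (IsMaxPal w (firstProd c k).length (c k) ∨
        ((∀ u, ¬ IsEarlierPalindrome w (firstProd c k).length u) ∧ (c k).length = 1))) :
    IsPalCrochemore w c := by
  refine ⟨⟨fun k => ?_, fun N => ⟨N + 1, ?_⟩⟩, fun k => ?_⟩
  · induction k with
    | zero => exact occursAt_nil 0
    | succ k ih =>
      rw [firstProd_succ, occursAt_append]
      exact ⟨ih, by simpa using (h k).2.1⟩
  · have key : ∀ k, k ≤ (firstProd c k).length := by
      intro k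
      induction k with
      | zero => simp
      | succ k ih =>
        have := List.length_pos_iff.2 (h k).1
        rw [firstProd_succ, List.length_append]
        omega
    exact key (N + 1)
  · rcases (h k).2.2 with h' | h'
    · exact .inl ⟨h'.1.resolve_left (h k).1, h'.2⟩
    · exact .inr h'

/-- The first letter of an earlier palindrome would itself occur earlier; this is the criterion for
the single-letter factors. -/
theorem not_isEarlierPalindrome_of_forall_ne {p : ℕ} (h : ∀ j < p, w j ≠ w p) (u : List α) :
    ¬ IsEarlierPalindrome w p u := by
  rintro ⟨hne, -, hp, j, hj, hu⟩
  have h0 := List.length_pos_iff.2 hne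
  exact h j hj ((hu 0 h0).symm.trans (hp 0 h0))

theorem palindrome_cons_append_singleton {a : α} {t : List α} :
    (a :: (t ++ [a])).Palindrome ↔ t.Palindrome := by
  simp [List.Palindrome.iff_reverse_eq]

theorem exists_eq_cons_append_singleton {a : α} {t : List α} (h : (a :: t).Palindrome) :
    ∃ s, a :: t = s ++ [a] := by
  rw [List.Palindrome.iff_reverse_eq] at h
  exact ⟨t.reverse, by rw [← h]; simp⟩

end Occurrences

/-! ### Desubstitution and transport of maximal palindromes -/

theorem phi_cons (m a : ℕ) (u : List ℕ) : phi m (a :: u) = phiLetter m a ++ phi m u := by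
  simp [phi]

theorem phi_nil (m : ℕ) : phi m [] = [] := rfl

theorem phi_singleton (m a : ℕ) : phi m [a] = phiLetter m a := by
  simp [phi]

/-- Each block `0b` or `0` satisfies `0 · reverse(block) = block · 0`, so a `0` can be pushed
through block by block. -/
theorem cons_reverse_phi (m : ℕ) (v : List ℕ) :
    0 :: (phi m v).reverse = phi m v.reverse ++ [0] := by
  induction v with
  | nil => rfl
  | cons a v ih =>
    rw [phi_cons, List.reverse_append, List.reverse_cons, phi_append, phi_singleton,
      ← List.cons_append, ih]
    unfold phiLetter
    split <;> simp

theorem reverse_phi_append_zero (m : ℕ) (v : List ℕ) :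
    (phi m v ++ [0]).reverse = phi m v.reverse ++ [0] := by
  rw [← cons_reverse_phi]
  simp

section Positions

variable {m : ℕ}

/-- The position at which the image of the letter at position `n` starts. -/
def pos (m n : ℕ) : ℕ :=
  (phi m ((List.range n).map (mbonacci m))).length

theorem pos_zero (m : ℕ) : pos m 0 = 0 := rfl

theorem pos_succ (m n : ℕ) : pos m (n + 1) = pos m n + (phiLetter m (mbonacci m n)).length := by
  simp [pos, List.range_succ, phi_append, phi_singleton]

theorem occursAt_phiLetter (hm : 2 ≤ m) (n : ℕ) :
    OccursAt (mbonacci m) (phiLetter m (mbonacci m n)) (pos m n) := by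
  have := mbonacci_fixed hm (n + 1)
  rw [List.range_succ, List.map_append, phi_append, occursAt_append] at this
  simpa [pos, phi_singleton] using this.2

theorem mbonacci_pos (hm : 2 ≤ m) (n : ℕ) : mbonacci m (pos m n) = 0 := by
  have := occursAt_phiLetter hm n
  unfold phiLetter at this
  split at this <;> simp only [occursAt_cons] at this <;> exact this.1.symm

theorem pos_succ_of_lt {n : ℕ} (h : mbonacci m n + 1 < m) : pos m (n + 1) = pos m n + 2 := by
  simp [pos_succ, phiLetter, h]

theorem pos_succ_of_not_lt {n : ℕ} (h : ¬ mbonacci m n + 1 < m) :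
    pos m (n + 1) = pos m n + 1 := by
  simp [pos_succ, phiLetter, h]

theorem mbonacci_pos_add_one (hm : 2 ≤ m) {n : ℕ} (h : mbonacci m n + 1 < m) :
    mbonacci m (pos m n + 1) = mbonacci m n + 1 := by
  have := occursAt_phiLetter hm n
  simp only [phiLetter, h, if_true, occursAt_cons] at this
  exact this.2.1.symm

theorem pos_strictMono (m : ℕ) : StrictMono (pos m) := by
  refine strictMono_nat_of_lt_succ fun n => ?_
  by_cases h : mbonacci m n + 1 < m
  · rw [pos_succ_of_lt h]; omega
  · rw [pos_succ_of_not_lt h]; omega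

theorem exists_pos_eq_or (m i : ℕ) :
    (∃ j, i = pos m j) ∨ ∃ j, i = pos m j + 1 ∧ mbonacci m j + 1 < m := by
  induction i with
  | zero => exact .inl ⟨0, rfl⟩
  | succ i ih =>
    rcases ih with ⟨j, rfl⟩ | ⟨j, rfl, hj⟩
    · by_cases h : mbonacci m j + 1 < m
      · exact .inr ⟨j, rfl, h⟩
      · exact .inl ⟨j + 1, (pos_succ_of_not_lt h).symm⟩
    · exact .inl ⟨j + 1, (pos_succ_of_lt hj).symm⟩

theorem exists_pos_eq (hm : 2 ≤ m) {i : ℕ} (hi : mbonacci m i = 0) : ∃ j, i = pos m j := by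
  rcases exists_pos_eq_or m i with h | ⟨j, rfl, hj⟩
  · exact h
  · rw [mbonacci_pos_add_one hm hj] at hi
    omega

theorem mbonacci_ne_zero (hm : 2 ≤ m) {i : ℕ} (hi : mbonacci m i ≠ 0) :
    ∃ j, i = j + 1 ∧ mbonacci m j = 0 ∧ mbonacci m (i + 1) = 0 := by
  rcases exists_pos_eq_or m i with ⟨j, rfl⟩ | ⟨j, rfl, hj⟩
  · exact absurd (mbonacci_pos hm j) hi
  · refine ⟨_, rfl, mbonacci_pos hm j, ?_⟩
    have := mbonacci_pos hm (j + 1)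
    rwa [pos_succ_of_lt hj] at this

theorem OccursAt.pos_add_length {v : List ℕ} {j : ℕ} (h : OccursAt (mbonacci m) v j) :
    pos m (j + v.length) = pos m j + (phi m v).length := by
  induction v generalizing j with
  | nil => simp [phi_nil]
  | cons a v ih =>
    rw [occursAt_cons] at h
    rw [List.length_cons, show j + (v.length + 1) = j + 1 + v.length by omega, ih h.2, pos_succ,
      phi_cons, List.length_append, h.1]
    omega

theorem OccursAt.image (hm : 2 ≤ m) {v : List ℕ} {j : ℕ} (h : OccursAt (mbonacci m) v j) :
    OccursAt (mbonacci m) (phi m v) (pos m j) := by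
  induction v generalizing j with
  | nil => exact occursAt_nil _
  | cons a v ih =>
    rw [occursAt_cons] at h
    rw [phi_cons, occursAt_append, h.1, ← pos_succ]
    exact ⟨occursAt_phiLetter hm j, ih h.2⟩

theorem OccursAt.image_append_zero (hm : 2 ≤ m) {v : List ℕ} {j : ℕ}
    (h : OccursAt (mbonacci m) v j) : OccursAt (mbonacci m) (phi m v ++ [0]) (pos m j) := by
  rw [occursAt_append, occursAt_singleton, ← h.pos_add_length, mbonacci_pos hm]
  exact ⟨h.image hm, rfl⟩

theorem phi_append_zero_eq_cons (m : ℕ) (v : List ℕ) : ∃ t, phi m v ++ [0] = 0 :: t := by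
  cases v with
  | nil => exact ⟨[], rfl⟩
  | cons a v =>
    rw [phi_cons]
    unfold phiLetter
    split <;> simp

/-- The final `0` makes the decoding unambiguous: the image `0` of `m-1` is a prefix of every other
block and is recognised only by the `0` that follows it. The bound on letters is needed because
`phiLetter` sends every letter from `m-1` on to `0`. -/
theorem occursAt_of_phi_append_zero (hm : 2 ≤ m) {v : List ℕ} {j : ℕ} (hv : ∀ a ∈ v, a < m)
    (h : OccursAt (mbonacci m) (phi m v ++ [0]) (pos m j)) : OccursAt (mbonacci m) v j := by
  induction v generalizing j with
  | nil => exact occursAt_nil _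
  | cons a v ih =>
    have ha := hv a (by simp)
    rw [phi_cons, List.append_assoc, occursAt_append] at h
    obtain ⟨h1, h2⟩ := h
    have haj : a = mbonacci m j := by
      have hj := mbonacci_lt hm j
      by_cases h : mbonacci m j + 1 < m
      · have hs := mbonacci_pos_add_one hm h
        by_cases h' : a + 1 < m
        · simp only [phiLetter, h', if_true, occursAt_cons] at h1
          omega
        · obtain ⟨t, ht⟩ := phi_append_zero_eq_cons m v
          simp only [phiLetter, h', if_false, ht, occursAt_cons, List.length_singleton] at h2
          omega
      · have hs := mbonacci_pos hm (j + 1)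
        rw [pos_succ_of_not_lt h] at hs
        by_cases h' : a + 1 < m
        · simp only [phiLetter, h', if_true, occursAt_cons] at h1
          omega
        · omega
    rw [occursAt_cons]
    refine ⟨haj, ih (fun b hb => hv b (by simp [hb])) ?_⟩
    rwa [haj, ← pos_succ] at h2

theorem OccursAt.lt (hm : 2 ≤ m) {v : List ℕ} {j : ℕ} (h : OccursAt (mbonacci m) v j) :
    ∀ a ∈ v, a < m := by
  intro a ha
  obtain ⟨i, hi, rfl⟩ := List.getElem_of_mem ha
  rw [h i hi]
  exact mbonacci_lt hm _

/-- Desubstitution: a factor starting and ending with `0` is of the form `φ(v)0`. -/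
theorem exists_eq_phi_append_zero (hm : 2 ≤ m) {u : List ℕ} {p : ℕ}
    (h : OccursAt (mbonacci m) (u ++ [0]) (pos m p)) :
    ∃ v, u = phi m v ∧ OccursAt (mbonacci m) v p := by
  rw [occursAt_append, occursAt_singleton] at h
  obtain ⟨r, hr⟩ := exists_pos_eq hm h.2.symm
  have hpr : p ≤ r := (pos_strictMono m).le_iff_le.1 (by omega)
  obtain ⟨d, rfl⟩ := Nat.exists_eq_add_of_le hpr
  have ho := occursAt_map_range (w := mbonacci m) p d
  have hl := ho.pos_add_length
  rw [List.length_map, List.length_range] at hl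
  exact ⟨_, h.1.eq_of_length_eq (ho.image hm) (by omega), ho⟩

theorem palindrome_of_palindrome_phi (hm : 2 ≤ m) {v : List ℕ} {p : ℕ}
    (h : OccursAt (mbonacci m) v p) (hp : (phi m v ++ [0]).Palindrome) : v.Palindrome := by
  have h1 := h.image_append_zero hm
  rw [List.Palindrome.iff_reverse_eq, reverse_phi_append_zero] at hp
  rw [← hp] at h1
  rw [List.Palindrome.iff_reverse_eq]
  exact (occursAt_of_phi_append_zero hm (by simpa using h.lt hm) h1).eq_of_length_eq h (by simp)

theorem IsMaxPal.image (hm : 2 ≤ m) {u : List ℕ} {p : ℕ} (hp : 0 < p)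
    (h : IsMaxPal (mbonacci m) p u) : IsMaxPal (mbonacci m) (pos m p) (phi m u ++ [0]) := by
  refine ⟨.inr ⟨by simp, ?_, h.occursAt.image_append_zero hm, ?_⟩, ?_⟩
  · have := h.palindrome
    rw [List.Palindrome.iff_reverse_eq] at this ⊢
    rw [reverse_phi_append_zero, this]
  · rcases h.1 with rfl | ⟨-, -, -, j, hj, hu⟩
    -- For `u = ε` the image is the single letter `0`, which already occurs at position `0`; here `0
    -- < p` is used.
    · exact ⟨pos m 0, pos_strictMono m hp, (occursAt_nil 0).image_append_zero hm⟩
    · exact ⟨pos m j, pos_strictMono m hj, hu.image_append_zero hm⟩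
  · rintro v ⟨hne, hpal, hv, j, hj, hvj⟩
    obtain ⟨a, t, rfl⟩ := List.exists_cons_of_ne_nil hne
    obtain rfl : a = 0 := (occursAt_cons.1 hv).1.trans (mbonacci_pos hm p)
    obtain ⟨j, rfl⟩ := exists_pos_eq hm (occursAt_cons.1 hvj).1.symm
    obtain ⟨s, hs⟩ := exists_eq_cons_append_singleton hpal
    rw [hs] at hv hvj hpal ⊢
    obtain ⟨v, rfl, hvp⟩ := exists_eq_phi_append_zero hm hv
    have hle : v.length ≤ u.length := by
      by_cases h0 : v = []
      · simp [h0]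
      · exact h.2 v ⟨h0, palindrome_of_palindrome_phi hm hvp hpal, hvp, j,
          (pos_strictMono m).lt_iff_lt.1 hj, occursAt_of_phi_append_zero hm (hvp.lt hm) hvj⟩
    -- Both preimages start at `p`, so monotonicity of `pos` turns the comparison of their lengths
    -- into one for the images.
    have h1 := hvp.pos_add_length
    have h2 := h.occursAt.pos_add_length
    have h3 := (pos_strictMono m).monotone (Nat.add_le_add_left hle p)
    simp only [List.length_append]
    omega

/-- Nonzero letters are isolated between zeros, so every occurrence of a palindrome with nonzero end
letters extends by `0` on both sides. A longer competitor at `p + 1` would therefore give a longer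
one at `p`. -/
theorem IsMaxPal.strip (hm : 2 ≤ m) {t : List ℕ} {p : ℕ} (ht : t ≠ [])
    (h : IsMaxPal (mbonacci m) p (0 :: (t ++ [0]))) (hp : mbonacci m (p + 1) ≠ 0) :
    IsMaxPal (mbonacci m) (p + 1) t := by
  obtain ⟨-, hpal, ho, j, hj, hoj⟩ := h.1.resolve_left (by simp)
  rw [occursAt_cons, occursAt_append] at ho hoj
  refine ⟨.inr ⟨ht, palindrome_cons_append_singleton.1 hpal, ho.2.1, j + 1, by omega, hoj.2.1⟩,
    ?_⟩
  rintro v ⟨hne, hvpal, hv, i, hi, hvi⟩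
  obtain ⟨a, s, hs⟩ := List.exists_cons_of_ne_nil hne
  have ha : a ≠ 0 := by
    rw [hs, occursAt_cons] at hv
    rw [hv.1]; exact hp
  have extend : ∀ k, OccursAt (mbonacci m) v k →
      ∃ l, k = l + 1 ∧ OccursAt (mbonacci m) (0 :: (v ++ [0])) l := by
    intro k hk
    have hk0 : mbonacci m k ≠ 0 := by
      have := hk
      rw [hs, occursAt_cons] at this
      rwa [← this.1]
    obtain ⟨l, rfl, hl, -⟩ := mbonacci_ne_zero hm hk0
    obtain ⟨s', hs'⟩ := exists_eq_cons_append_singleton (hs ▸ hvpal)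
    have hlast : mbonacci m (l + 1 + s'.length) ≠ 0 := by
      have := hk
      rw [hs, hs', occursAt_append, occursAt_singleton] at this
      rwa [← this.2]
    obtain ⟨-, -, -, hl'⟩ := mbonacci_ne_zero hm hlast
    refine ⟨l, rfl, ?_⟩
    rw [occursAt_cons, occursAt_append, occursAt_singleton]
    refine ⟨hl.symm, hk, ?_⟩
    rw [hs, hs', List.length_append, List.length_singleton, ← add_assoc, hl']
  obtain ⟨l, hl, hvl⟩ := extend _ hv
  obtain ⟨i', rfl, hvi'⟩ := extend _ hvi
  obtain rfl : p = l := by omega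
  have := h.2 _ ⟨by simp, palindrome_cons_append_singleton.2 hvpal, hvl, i', by omega, hvi'⟩
  simpa using this

end Positions

/-! ### The morphism on p-singular words -/

/-- The word `0` for odd `k`, and the empty word for even `k`. -/
def oddZero (k : ℕ) : List ℕ := if k % 2 = 1 then [0] else []

theorem oddZero_congr {a b : ℕ} (h : a % 2 = b % 2) : oddZero a = oddZero b := by
  simp [oddZero, h]

/-- The relation `z_k = φ(z_{k-1})0` for even `k` and `0z_k = φ(z_{k-1})` for odd `k`. -/
def PhiRel (m k : ℕ) : Prop :=
  oddZero k ++ zShift m (k + 1) = phi m (zShift m k) ++ oddZero (k + 1)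

section Chains

variable {m : ℕ} {g : ℕ → ℕ} {r : ℕ}

/-- The product telescopes: parities alternate along the chain, so the boundary `0` left over by one
block is the one the next block needs. Only parity is assumed of `g`, so both increasing and
decreasing index chains are covered. -/
theorem phi_ascent (hg : ∀ i < r, (g i + 1) % 2 = g (i + 1) % 2) (h : ∀ i < r, PhiRel m (g i)) :
    oddZero (g 0) ++ (List.range r).flatMap (fun i => zShift m (g i + 1)) =
      phi m ((List.range r).flatMap fun i => zShift m (g i)) ++ oddZero (g r) := by
  induction r with
  | zero => simp [phi_nil]
  | succ r ih =>
    have h1 := ih (fun i hi => hg i (by omega)) (fun i hi => h i (by omega))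
    have h2 := h r (by omega)
    rw [PhiRel, oddZero_congr (hg r (by omega))] at h2
    simp only [List.range_succ, List.flatMap_append, List.flatMap_singleton, phi_append,
      List.append_assoc, ← h2]
    rw [← List.append_assoc, h1, List.append_assoc]

theorem phi_descent (hg : ∀ i < r, (g i + 1) % 2 = g (i + 1) % 2) (h : ∀ i < r, PhiRel m (g i)) :
    oddZero (g r + 1) ++ (List.range r).reverse.flatMap (fun i => zShift m (g i + 1)) =
      phi m ((List.range r).reverse.flatMap fun i => zShift m (g i)) ++ oddZero (g 0 + 1) := by
  induction r with
  | zero => simp [phi_nil]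
  | succ r ih =>
    have h1 := ih (fun i hi => hg i (by omega)) (fun i hi => h i (by omega))
    have h2 := h r (by omega)
    have h3 := hg r (by omega)
    rw [PhiRel] at h2
    simp only [List.range_succ, List.reverse_append, List.reverse_singleton, List.flatMap_append,
      List.flatMap_singleton, phi_append, List.append_assoc, ← h1]
    rw [← List.append_assoc, ← List.append_assoc, ← h2,
      oddZero_congr (show (g (r + 1) + 1) % 2 = g r % 2 by omega)]

theorem phi_ascent_descent (hg : ∀ i < r, (g i + 1) % 2 = g (i + 1) % 2)
    (h : ∀ i ≤ r, PhiRel m (g i)) :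
    oddZero (g 0) ++ ((List.range r).flatMap (fun i => zShift m (g i + 1)) ++
        zShift m (g r + 1) ++ (List.range r).reverse.flatMap (fun i => zShift m (g i + 1))) =
      phi m ((List.range r).flatMap (fun i => zShift m (g i)) ++ zShift m (g r) ++
        (List.range r).reverse.flatMap (fun i => zShift m (g i))) ++ oddZero (g 0 + 1) := by
  have h1 := phi_ascent hg fun i hi => h i hi.le
  have h2 := phi_descent hg fun i hi => h i hi.le
  have h3 := h r le_rfl
  rw [PhiRel] at h3
  simp only [phi_append, List.append_assoc, ← h2]
  rw [← List.append_assoc, h1, List.append_assoc]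
  congr 1
  rw [← List.append_assoc, h3, List.append_assoc]

end Chains

theorem zShift_zero (m : ℕ) : zShift m 0 = [] := by rw [zShift]

theorem zShift_one (m : ℕ) : zShift m 1 = [0] := by rw [zShift]

theorem zShift_add_two_of_lt {m k : ℕ} (h : k + 1 < m) :
    zShift m (k + 2) = (List.range k).flatMap (fun i => zShift m (k - i)) ++ [k + 1] ++
      (List.range k).reverse.flatMap (fun i => zShift m (k - i)) := by
  rw [zShift, if_pos h]

theorem zShift_add_two_of_not_lt {m k : ℕ} (h : ¬ k + 1 < m) :
    zShift m (k + 2) =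
      (List.range (m - 1)).flatMap (fun i => zShift m (k - i)) ++ zShift m (k + 1 - m) ++
        (List.range (m - 1)).reverse.flatMap (fun i => zShift m (k - i)) := by
  rw [zShift, if_neg h]

theorem flatMap_range_congr {f g : ℕ → List ℕ} {r : ℕ} (h : ∀ i < r, f i = g i) :
    (List.range r).flatMap f = (List.range r).flatMap g :=
  List.flatMap_congr fun i hi => h i (List.mem_range.1 hi)

theorem flatMap_range_reverse_congr {f g : ℕ → List ℕ} {r : ℕ} (h : ∀ i < r, f i = g i) :
    (List.range r).reverse.flatMap f = (List.range r).reverse.flatMap g :=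
  List.flatMap_congr fun i hi => h i (by simpa using hi)

/-- The two new innermost factors `z_0 = 0` come from different sources: the left one is the leading
`0` of the image of the central letter, the right one is the boundary `0` of the descending chain.
-/
theorem phiRel_add_two_of_lt {m k : ℕ} (hk : k + 1 < m) (ih : ∀ i ≤ k, PhiRel m i) :
    oddZero k ++ ((List.range (k + 1)).flatMap (fun i => zShift m (k + 1 - i)) ++
        (phi m [k + 1]).tail ++
        (List.range (k + 1)).reverse.flatMap (fun i => zShift m (k + 1 - i))) =
      phi m (zShift m (k + 2)) ++ oddZero (k + 1) := by
  have hg : ∀ i < k, (k - i + 1) % 2 = (k - (i + 1)) % 2 := fun i hi => by omega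
  have h1 := phi_ascent (g := fun i => k - i) hg fun i hi => ih _ (by omega)
  have h2 := phi_descent (g := fun i => k - i) hg fun i hi => ih _ (by omega)
  have e1 : (List.range k).flatMap (fun i => zShift m (k + 1 - i)) =
      (List.range k).flatMap (fun i => zShift m (k - i + 1)) :=
    flatMap_range_congr fun i hi => by rw [Nat.sub_add_comm (by omega)]
  have e2 : (List.range k).reverse.flatMap (fun i => zShift m (k + 1 - i)) =
      (List.range k).reverse.flatMap (fun i => zShift m (k - i + 1)) :=
    flatMap_range_reverse_congr fun i hi => by rw [Nat.sub_add_comm (by omega)]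
  obtain ⟨t, ht⟩ : ∃ t, phi m [k + 1] = 0 :: t := by
    rw [phi_singleton, phiLetter]; split <;> exact ⟨_, rfl⟩
  simp only [Nat.sub_self, Nat.sub_zero] at h1 h2
  rw [show oddZero 0 = [] from rfl, List.append_nil] at h1
  rw [show oddZero (0 + 1) = [0] from rfl] at h2
  rw [zShift_add_two_of_lt hk, phi_append, phi_append, ht, List.tail_cons]
  simp only [List.range_succ, List.reverse_append, List.reverse_singleton, List.flatMap_append,
    List.flatMap_nil, List.flatMap_cons, e1, e2, Nat.add_sub_cancel_left, zShift_one, List.append_assoc, ← h1,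
    ← h2, List.cons_append, List.nil_append]

theorem phiRel {m : ℕ} (hm : 2 ≤ m) (k : ℕ) : PhiRel m k := by
  induction k using Nat.strong_induction_on with
  | _ k ih =>
    match k with
    | 0 => simp [PhiRel, oddZero, zShift_zero, zShift_one, phi_nil]
    | 1 =>
      rw [PhiRel, zShift_add_two_of_lt (by omega), zShift_one]
      simp [oddZero, phi_singleton, phiLetter, show 1 < m by omega]
    | k + 2 =>
      rw [PhiRel, oddZero_congr (show (k + 2) % 2 = k % 2 by omega),
        oddZero_congr (show (k + 2 + 1) % 2 = (k + 1) % 2 by omega)]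
      by_cases hk : k + 1 < m
      · rw [← phiRel_add_two_of_lt hk fun i hi => ih i (by omega)]
        by_cases hk' : k + 2 < m
        · rw [zShift_add_two_of_lt hk', phi_singleton, phiLetter, if_pos hk', List.tail_cons]
        -- Transition between the two recursions: the letter `m-1` has image `0`, whose tail is
        -- empty and matches the central `z_{-1} = ε`.
        · obtain rfl : m = k + 2 := by omega
          rw [zShift_add_two_of_not_lt hk', phi_singleton, phiLetter, if_neg hk', Nat.sub_self,
            zShift_zero, List.tail_cons]
          rfl
      · have h := phi_ascent_descent (m := m) (g := fun i => k - i) (r := m - 1)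
          (fun i hi => by omega) fun i hi => ih _ (by omega)
        rw [zShift_add_two_of_not_lt hk, zShift_add_two_of_not_lt (k := k + 1) (by omega)]
        rw [show k + 1 - m = k - (m - 1) by omega]
        simp only [Nat.sub_zero] at h
        rw [← h, show k + 1 + 1 - m = k - (m - 1) + 1 by omega,
          flatMap_range_congr (f := fun i => zShift m (k + 1 - i))
            (g := fun i => zShift m (k - i + 1)) fun i hi => by rw [Nat.sub_add_comm (by omega)],
          flatMap_range_reverse_congr (f := fun i => zShift m (k + 1 - i))
            (g := fun i => zShift m (k - i + 1)) fun i hi => by rw [Nat.sub_add_comm (by omega)]]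

theorem phi_mountain {m : ℕ} (hm : 2 ≤ m) (a r : ℕ) :
    oddZero a ++ mountain (zShift m) (a + 1) r =
      phi m (mountain (zShift m) a r) ++ oddZero (a + 1) := by
  have h := phi_ascent_descent (m := m) (g := fun i => a + i) (r := r)
    (fun i _ => by omega) fun i _ => phiRel hm _
  simpa only [mountain, Nat.add_right_comm a 1, Nat.add_zero] using h

theorem phi_mountain_of_even {m a : ℕ} (hm : 2 ≤ m) (r : ℕ) (ha : a % 2 = 0) :
    mountain (zShift m) (a + 1) r = phi m (mountain (zShift m) a r) ++ [0] := by
  simpa [oddZero, show a % 2 ≠ 1 by omega, show (a + 1) % 2 = 1 by omega]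
    using phi_mountain hm a r

theorem phi_mountain_of_odd {m a : ℕ} (hm : 2 ≤ m) (r : ℕ) (ha : a % 2 = 1) :
    0 :: mountain (zShift m) (a + 1) r = phi m (mountain (zShift m) a r) := by
  simpa [oddZero, show (a + 1) % 2 ≠ 1 by omega, ha] using phi_mountain hm a r

/-! ### The palindromes `P_l` and the initial maximal palindromes -/

theorem mountain_succ (f : ℕ → List ℕ) (a r : ℕ) :
    mountain f a (r + 1) = f a ++ mountain f (a + 1) r ++ f a := by
  simp only [mountain, List.range_succ_eq_map, List.flatMap_cons, List.reverse_cons,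
    List.flatMap_append, ← List.map_reverse, List.flatMap_map, Nat.succ_eq_add_one,
    Nat.add_right_comm a 1]
  simp [Nat.add_assoc]

/-- The words `P_0 = ε`, `P_{l+1} = φ(P_l)0`. -/
def pal (m : ℕ) : ℕ → List ℕ
  | 0 => []
  | l + 1 => phi m (pal m l) ++ [0]

theorem mountain_one_eq_pal {m : ℕ} (hm : 2 ≤ m) (r : ℕ) :
    mountain (zShift m) 1 r = pal m (r + 1) := by
  induction r with
  | zero => simp [mountain, pal, zShift_one, phi_nil]
  | succ r ih =>
    rw [mountain_succ, zShift_one, pal, ← ih, ← phi_mountain_of_odd hm r rfl]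
    rfl

theorem mountain_z_eq_pal {m : ℕ} (hm : 2 ≤ m) (r : ℕ) : mountain (z m) 0 r = pal m (r + 1) := by
  rw [← mountain_one_eq_pal hm]
  simp [mountain, z, Nat.add_comm 1]

theorem mountain_zero_eq_pal {m : ℕ} (hm : 2 ≤ m) (r : ℕ) :
    mountain (zShift m) 0 r = pal m r := by
  cases r with
  | zero => simp [mountain, pal, zShift_zero]
  | succ r => rw [mountain_succ, mountain_one_eq_pal hm, zShift_zero]; simp

theorem pal_succ_eq {m l : ℕ} (hl : l < m) : pal m (l + 1) = pal m l ++ [l] ++ pal m l := by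
  induction l with
  | zero => simp [pal, phi_nil]
  | succ l ih =>
    have e : pal m (l + 1 + 1) = phi m (pal m l ++ [l] ++ pal m l) ++ [0] := by
      rw [← ih (by omega), pal]
    rw [e, phi_append, phi_append, phi_singleton, phiLetter, if_pos hl]
    simp [pal]

theorem lt_of_mem_pal {m l : ℕ} (hl : l ≤ m) : ∀ a ∈ pal m l, a < l := by
  induction l with
  | zero => simp [pal]
  | succ l ih =>
    intro a ha
    have := ih (by omega)
    rw [pal_succ_eq (by omega)] at ha
    simp only [List.mem_append, List.mem_singleton] at ha
    rcases ha with (ha | rfl) | ha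
    · exact (this a ha).trans (by omega)
    · omega
    · exact (this a ha).trans (by omega)

theorem h_eq_pal_append {m l : ℕ} (hl : l < m) : h m l = pal m l ++ [l] := by
  induction l with
  | zero => rfl
  | succ l ih =>
    rw [h_succ, ih (by omega), phi_append, phi_singleton, phiLetter, if_pos hl]
    simp [pal]

theorem h_eq_pal {m : ℕ} (hm : 2 ≤ m) : h m m = pal m m := by
  obtain ⟨l, rfl⟩ : ∃ l, m = l + 1 := ⟨m - 1, by omega⟩
  rw [h_succ, h_eq_pal_append (by omega), phi_append, phi_singleton, phiLetter, if_neg (by omega)]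
  rfl

theorem pos_length_h {m : ℕ} (hm : 2 ≤ m) (l : ℕ) :
    pos m (h m l).length = (h m (l + 1)).length := by
  simpa [pos_zero, h_succ] using (mbonacci_occursAt hm l).pos_add_length

/-- The induction starts from the empty word at position `1`, where the letter `1` is new; this is
why `IsMaxPal` admits `ε`. Each further step is `IsMaxPal.image`. -/
theorem isMaxPal_length_h {m : ℕ} (hm : 2 ≤ m) (l : ℕ) :
    IsMaxPal (mbonacci m) (h m l).length (pal m l) := by
  induction l with
  | zero =>
    refine ⟨.inl rfl, fun v hv => ?_⟩
    have h1 : mbonacci m 1 = 1 :=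
      mbonacci_pos_add_one (n := 0) hm (by rw [mbonacci_zero]; omega)
    refine absurd hv (not_isEarlierPalindrome_of_forall_ne (fun j hj => ?_) v)
    have hj : j < 1 := hj
    obtain rfl : j = 0 := by omega
    change mbonacci m 0 ≠ mbonacci m 1
    rw [h1, mbonacci_zero]
    omega
  | succ l ih =>
    rw [← pos_length_h hm]
    exact ih.image hm (by have := lt_length_h hm l; omega)

/-! ### Maximality of the factors `Q(n)` -/

theorem mountain_zShift_ne_nil {m a : ℕ} (hm : 2 ≤ m) (ha : 0 < a) (r : ℕ) :
    mountain (zShift m) a r ≠ [] := by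
  induction a with
  | zero => omega
  | succ a ih =>
    rcases Nat.mod_two_eq_zero_or_one a with h | h
    · simp [phi_mountain_of_even hm r h]
    · have h1 := phi_mountain_of_odd hm r h
      intro h0
      obtain ⟨b, u, hu⟩ := List.exists_cons_of_ne_nil (ih (by omega))
      obtain ⟨c, rfl⟩ : ∃ c, a = c + 1 := ⟨a - 1, by omega⟩
      obtain ⟨t, ht⟩ := phi_append_zero_eq_cons m (mountain (zShift m) c r)
      rw [← phi_mountain_of_even hm r (by omega)] at ht
      -- The preceding word starts with `0`, so its image starts with `01` and cannot reduce to the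
      -- single letter `0`.
      rw [h0, ht, phi_cons, phiLetter, if_pos (by omega)] at h1
      simp at h1

/-- The starting position of the `d`-th factor `Q(m-2+d)`. -/
def start (m d : ℕ) : ℕ :=
  (h m (m - 1)).length + (firstProd (fun d => mountain (zShift m) d (m - 1)) d).length

theorem start_succ (m d : ℕ) :
    start m (d + 1) = start m d + (mountain (zShift m) d (m - 1)).length := by
  simp [start, firstProd_succ, add_assoc]

/-- The position formula is proved together with maximality: it says whether the next factor starts
at the image position or one letter later, which decides whether stripping is needed. -/
theorem isMaxPal_start {m : ℕ} (hm : 2 ≤ m) (d : ℕ) :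
    IsMaxPal (mbonacci m) (start m d) (mountain (zShift m) d (m - 1)) ∧
      start m (d + 1) = pos m (start m d) + d % 2 := by
  induction d with
  | zero =>
    have h0 : start m 0 = (h m (m - 1)).length := rfl
    rw [start_succ, h0, mountain_zero_eq_pal hm, pos_length_h hm]
    refine ⟨isMaxPal_length_h hm _, ?_⟩
    obtain ⟨l, rfl⟩ : ∃ l, m = l + 1 := ⟨m - 1, by omega⟩
    rw [Nat.add_sub_cancel, h_eq_pal hm, h_eq_pal_append (by omega), pal_succ_eq (by omega)]
    simp only [List.length_append]
    omega
  | succ d ih =>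
    obtain ⟨ih1, ih2⟩ := ih
    have hpos : 0 < start m d := by
      have := lt_length_h hm (m - 1)
      unfold start
      omega
    have himg := ih1.image hm hpos
    have hlen := ih1.occursAt.pos_add_length
    rw [← start_succ] at hlen
    rw [start_succ m (d + 1)]
    rcases Nat.mod_two_eq_zero_or_one d with h | h
    · rw [h, add_zero] at ih2
      have h2 := phi_mountain_of_even hm (m - 1) h
      refine ⟨by rw [ih2, h2]; exact himg, ?_⟩
      rw [hlen, ih2, h2, List.length_append, List.length_singleton]
      omega
    · rw [h] at ih2
      have h2 := phi_mountain_of_odd hm (m - 1) h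
      -- For odd `d` the current factor has the form `φ(·)0`, hence starts with `0`; the image of
      -- that letter is `01`, so the letter after the image position is nonzero, as stripping
      -- requires.
      have hw : mbonacci m (start m d) = 0 := by
        obtain ⟨c, rfl⟩ : ∃ c, d = c + 1 := ⟨d - 1, by omega⟩
        obtain ⟨t, ht⟩ := phi_append_zero_eq_cons m (mountain (zShift m) c (m - 1))
        rw [← phi_mountain_of_even hm (m - 1) (by omega)] at ht
        have := ih1.occursAt
        rw [ht, occursAt_cons] at this
        exact this.1.symm
      have hw' : mbonacci m (pos m (start m d) + 1) ≠ 0 := by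
        rw [mbonacci_pos_add_one hm (by omega)]
        omega
      rw [← h2] at himg
      refine ⟨?_, ?_⟩
      · rw [ih2]
        exact himg.strip hm (mountain_zShift_ne_nil hm (by omega) _) hw'
      · rw [hlen, ih2, ← h2, List.length_cons]
        omega

/-! ### The initial factors and the assembled factorization -/

theorem q_even {m : ℕ} (hm : 2 ≤ m) (l : ℕ) (hl : 0 < l) : q m (2 * l) = pal m l := by
  rw [q, if_neg (by omega), if_neg (by omega), mountain_z_eq_pal hm]
  congr 1
  omega

theorem q_odd (m l : ℕ) : q m (2 * l + 1) = [l + 1] := by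
  rw [q, if_neg (by omega), if_pos (by omega)]
  congr 1
  omega

/-- Appending `P_l` and the letter `l+1` to `P_l l` gives `P_l l P_l (l+1) = P_{l+1} (l+1)`. -/
theorem firstProd_q {m : ℕ} (hm : 2 ≤ m) {l : ℕ} (hl : l + 1 < m) :
    firstProd (q m) (2 * (l + 1)) = h m (l + 1) := by
  induction l with
  | zero =>
    rw [h_eq_pal_append hl]
    simp [firstProd, List.range_succ, q, z, zShift_one, pal, phi_nil]
  | succ l ih =>
    rw [show 2 * (l + 1 + 1) = 2 * (l + 1) + 1 + 1 by omega, firstProd_succ, firstProd_succ,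
      ih (by omega), q_even hm _ (by omega), q_odd, h_eq_pal_append hl,
      h_eq_pal_append (l := l + 1) (by omega), pal_succ_eq (l := l + 1) (by omega)]

theorem firstProd_q_eq_pWord {m : ℕ} (hm : 2 ≤ m) :
    firstProd (q m) (2 * m - 2) = pWord m := by
  obtain ⟨l, rfl⟩ : ∃ l, m = l + 2 := ⟨m - 2, by omega⟩
  rw [show 2 * (l + 2) - 2 = 2 * (l + 1) by omega, firstProd_q hm (by omega),
    h_eq_pal_append (by omega), pWord, mountain_z_eq_pal hm]
  rfl

/-- The palindromic Crochemore factorization of the `m`-bonacci word. -/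
def crochemore (m k : ℕ) : List ℕ :=
  if k < 2 * m - 2 then q m k else Q m (k - m)

theorem crochemore_of_lt {m k : ℕ} (hk : k < 2 * m - 2) : crochemore m k = q m k := if_pos hk

theorem crochemore_add (m d : ℕ) (hm : 2 ≤ m) :
    crochemore m (2 * m - 2 + d) = mountain (zShift m) d (m - 1) := by
  rw [crochemore, if_neg (by omega), Q, show 2 * m - 2 + d - m + 2 - m = d by omega]

theorem firstProd_crochemore_of_le {m k : ℕ} (hk : k ≤ 2 * m - 2) :
    firstProd (crochemore m) k = firstProd (q m) k :=
  firstProd_congr fun _ hi => crochemore_of_lt (by omega)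

theorem length_firstProd_crochemore_add {m : ℕ} (hm : 2 ≤ m) (d : ℕ) :
    (firstProd (crochemore m) (2 * m - 2 + d)).length = start m d := by
  induction d with
  | zero =>
    obtain ⟨l, rfl⟩ : ∃ l, m = l + 2 := ⟨m - 2, by omega⟩
    rw [add_zero, firstProd_crochemore_of_le le_rfl,
      show 2 * (l + 2) - 2 = 2 * (l + 1) by omega, firstProd_q hm (by omega)]
    rfl
  | succ d ih =>
    rw [← add_assoc, firstProd_succ, List.length_append, ih, crochemore_add m d hm, start_succ]

theorem length_firstProd_q_odd {m l : ℕ} (hm : 2 ≤ m) (hl : l + 1 < m) :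
    (firstProd (q m) (2 * l + 1)).length = (pal m (l + 1)).length := by
  have h1 := congrArg List.length (firstProd_q hm hl)
  rw [show 2 * (l + 1) = 2 * l + 1 + 1 by omega, firstProd_succ, q_odd, h_eq_pal_append hl] at h1
  simpa using h1

theorem occursAt_pal {m l : ℕ} (hm : 2 ≤ m) (hl : l < m) :
    OccursAt (mbonacci m) (pal m l) 0 ∧ mbonacci m (pal m l).length = l := by
  have := mbonacci_occursAt hm l
  rw [h_eq_pal_append hl, occursAt_append, occursAt_singleton, Nat.zero_add] at this
  exact ⟨this.1, this.2.symm⟩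

/-- The prefix `P_l` uses only letters below `l`, and the letter right after it is `l`. -/
theorem not_isEarlierPalindrome_length_pal {m l : ℕ} (hm : 2 ≤ m) (hl : l < m) (u : List ℕ) :
    ¬ IsEarlierPalindrome (mbonacci m) (pal m l).length u := by
  obtain ⟨h1, h2⟩ := occursAt_pal hm hl
  refine not_isEarlierPalindrome_of_forall_ne (fun j hj => ?_) u
  have := lt_of_mem_pal hl.le _ (List.getElem_mem hj)
  rw [h1 j hj, Nat.zero_add] at this
  omega

theorem isPalCrochemore_crochemore {m : ℕ} (hm : 2 ≤ m) :
    IsPalCrochemore (mbonacci m) (crochemore m) := by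
  refine isPalCrochemore_of_occursAt fun k => ?_
  by_cases hk : k < 2 * m - 2
  · rw [firstProd_crochemore_of_le hk.le, crochemore_of_lt hk]
    rcases Nat.even_or_odd' k with ⟨l, rfl | rfl⟩
    · by_cases hl : l = 0
      · subst hl
        have hq : q m (2 * 0) = [0] := by simp [q, z, zShift_one]
        rw [hq]
        refine ⟨by simp, occursAt_singleton.2 (mbonacci_zero m).symm, .inr ⟨?_, rfl⟩⟩
        exact not_isEarlierPalindrome_of_forall_ne fun j hj => absurd hj (Nat.not_lt_zero j)
      · obtain ⟨l, rfl⟩ : ∃ i, l = i + 1 := ⟨l - 1, by omega⟩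
        have hmax := isMaxPal_length_h hm (l + 1)
        rw [q_even hm _ (by omega), firstProd_q hm (by omega)]
        exact ⟨by simp [pal], hmax.occursAt, .inl hmax⟩
    · have hl : l + 1 < m := by omega
      rw [length_firstProd_q_odd hm hl, q_odd]
      exact ⟨by simp, occursAt_singleton.2 (occursAt_pal hm hl).2.symm,
        .inr ⟨not_isEarlierPalindrome_length_pal hm hl, rfl⟩⟩
  · obtain ⟨d, rfl⟩ : ∃ d, k = 2 * m - 2 + d := ⟨k - (2 * m - 2), by omega⟩
    have hmax := (isMaxPal_start hm d).1
    rw [length_firstProd_crochemore_add hm, crochemore_add m d hm]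
    refine ⟨?_, hmax.occursAt, .inl hmax⟩
    rcases Nat.eq_zero_or_pos d with rfl | hd
    · obtain ⟨l, rfl⟩ : ∃ l, m = l + 2 := ⟨m - 2, by omega⟩
      rw [mountain_zero_eq_pal hm]
      simp [pal]
    · exact mountain_zShift_ne_nil hm hd _

theorem palindrome_q {m : ℕ} (hm : 2 ≤ m) (k : ℕ) : (q m k).Palindrome := by
  rcases Nat.even_or_odd' k with ⟨l, rfl | rfl⟩
  · rcases Nat.eq_zero_or_pos l with rfl | hl
    · simpa [q, z, zShift_one] using List.Palindrome.singleton 0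
    · rw [q_even hm l hl]
      exact (isMaxPal_length_h hm l).palindrome
  · rw [q_odd]
    exact .singleton _

end MBonacci

theorem mainTheorem1 (m : ℕ) (hm : 2 ≤ m) :
    (∃! c : ℕ → List ℕ, MBonacci.IsPalCrochemore (MBonacci.mbonacci m) c) ∧
    (∀ c : ℕ → List ℕ, MBonacci.IsPalCrochemore (MBonacci.mbonacci m) c →
      (∀ k < 2 * m - 2, c k = MBonacci.q m k) ∧
      (∀ n, m - 2 ≤ n → c (n + m) = MBonacci.Q m n)) ∧
    MBonacci.firstProd (MBonacci.q m) (2 * m - 2) = MBonacci.pWord m ∧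
    (∀ k < 2 * m - 2, (MBonacci.q m k).Palindrome) := by
  have hc := MBonacci.isPalCrochemore_crochemore hm
  refine ⟨⟨_, hc, fun c h => h.unique hc⟩, fun c h => ?_, MBonacci.firstProd_q_eq_pWord hm,
    fun k _ => MBonacci.palindrome_q hm k⟩
  obtain rfl := h.unique hc
  refine ⟨fun k hk => MBonacci.crochemore_of_lt hk, fun n hn => ?_⟩
  rw [MBonacci.crochemore, if_neg (by omega), Nat.add_sub_cancel]
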